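/- **Setting.** Let $Q$ be a finite-dimensional smooth manifold (without boundary), and let $S=\frac{\partial}{\partial v^i}\otimes dq^i$ and $\Delta=v^i\frac{\partial}{\partial v^i}$ be the canonical vertical endomorphism and the Liouville vector field on $TQ$; $S^*\alpha=\alpha\circ S$ denotes the dual action on covectors. For a smooth function $L\colon TQ\to\mathbb R$ put $\Theta_L=S^*(dL)$, $\omega_L=-d\Theta_L$, $E_L=\Delta(L)-L$, and let $\hat\omega_L\colon T(TQ)\to T^*(TQ)$, $u\mapsto \omega_L(u,\cdot)$. $L$ is *regular* if $\hat\omega_L$ is an isomorphism; then let $\Gamma_L$ be the vector field with $i_{\Gamma_L}\omega_L=dE_L$, let $\Lambda_L(\alpha,\beta)=\omega_L(\hat\omega_L^{-1}\alpha,\hat\omega_L^{-1}\beta)$ be the Poisson tensor, with associated bundle map $\Lambda_L=\hat\omega_L^{-1}\colon T^*(TQ)\to T(TQ)$, and let $H_L(\alpha,\beta)=\Lambda_L(S^*\alpha,\beta)$ be the Hessian of $L$. Horizontal covectors ($S^*\alpha=0$) always lie in the kernel of $H_L$; a regular $L$ is called *definite* if at each point of $TQ$ either $H_L(\alpha,\alpha)>0$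 for all covectors $\alpha$ with $S^*\alpha\neq0$, or $H_L(\alpha,\alpha)<0$ for all such $\alpha$. Let $C\subset TQ$ be a (possibly only immersed) smooth submanifold and let $D\to C$ be a smooth vector subbundle of $T_C(TQ)=T(TQ)|_C$ (the permitted directions), with annihilator $D^0\subset T^*_C(TQ)$. $D$ is *admissible* if $S^*$ is injective on $D^0_c$ for every $c\in C$. Given $F\subset T_C^*(TQ)$, a *solution of the non-holonomic Lagrangian problem* $(L,C,D,F)$ is a smooth vector field $\Gamma$ along $C$ (a smooth section of $T_C(TQ)$) such that $\Gamma(c)\in\Gamma_L(c)+\Lambda_L(F_c)$ and $\Gamma(c)\in D_c$ for all $c\in C$. It is a *SODE* if $S(\Gamma)=\Delta$ along $C$. **Theorem.** Let $L$ be a definite Lagrangian, let $D\to C$ be an admissible bundle of permitted directions, and let the reaction forces be given by Chetaev's bundle $F=S^*(D^0)$. Then there exists a unique SODE $\Gamma$ that is a solution of the non-holonomic Lagrangian problem $(L,C,D,F)$. -/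

import Mathlib

open scoped Manifold ContDiff

noncomputable section

namespace Nonholonomic

section ExteriorDerivative

variable {V H M : Type*} [NormedAddCommGroup V] [NormedSpace ℝ V] [TopologicalSpace H]
  (J : ModelWithCorners ℝ V H) [TopologicalSpace M] [ChartedSpace H M]

/-- The local representative of a `1`-form `θ` on `M` in the preferred chart at `p`: the pull-back
of `θ` by the inverse of the chart. -/
def oneFormInChart (θ : ∀ x : M, TangentSpace J x →L[ℝ] ℝ) (p : M) (y : V) : V →L[ℝ] ℝ :=
  (θ ((extChartAt J p).symm y)).comp (mfderiv 𝓘(ℝ, V) J (extChartAt J p).symm y)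

/-- The bilinear form `(a, b) ↦ D_a θ(b) - D_b θ(a)` on the model space, i.e. the exterior
derivative at the point `p`, read in the chart at `p`, of the `1`-form `θ`. -/
def extDerivOneFormInChart (θ : ∀ x : M, TangentSpace J x →L[ℝ] ℝ) (p : M) :
    V →L[ℝ] V →L[ℝ] ℝ :=
  fderiv ℝ (oneFormInChart J θ p) (extChartAt J p p) -
    (fderiv ℝ (oneFormInChart J θ p) (extChartAt J p p)).flip

/-- The exterior derivative `dθ` of a `1`-form on a manifold without boundary, as a bilinear form
on each tangent space: it is computed in the chart at `p` and pulled back to `T_p M` by the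
differential of the chart. -/
def extDerivOneForm (θ : ∀ x : M, TangentSpace J x →L[ℝ] ℝ) (p : M) :
    TangentSpace J p →L[ℝ] TangentSpace J p →L[ℝ] ℝ :=
  (ContinuousLinearMap.precomp ℝ
      (mfderiv J 𝓘(ℝ, V) (extChartAt J p) p : TangentSpace J p →L[ℝ] V)).comp
    ((extDerivOneFormInChart J θ p).comp
      (mfderiv J 𝓘(ℝ, V) (extChartAt J p) p : TangentSpace J p →L[ℝ] V))

theorem extDerivOneForm_apply (θ : ∀ x : M, TangentSpace J x →L[ℝ] ℝ) (p : M)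
    (u v : TangentSpace J p) :
    extDerivOneForm J θ p u v =
      fderiv ℝ (oneFormInChart J θ p) (extChartAt J p p)
          (mfderiv J 𝓘(ℝ, V) (extChartAt J p) p u) (mfderiv J 𝓘(ℝ, V) (extChartAt J p) p v) -
        fderiv ℝ (oneFormInChart J θ p) (extChartAt J p p)
          (mfderiv J 𝓘(ℝ, V) (extChartAt J p) p v) (mfderiv J 𝓘(ℝ, V) (extChartAt J p) p u) :=
  rfl

end ExteriorDerivative

section Lagrangian

variable {E : Type*} [NormedAddCommGroup E] [NormedSpace ℝ E]
  {Q : Type*} [TopologicalSpace Q] [ChartedSpace E Q] [IsManifold 𝓘(ℝ, E) ∞ Q]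

/-- The vertical lift `T_q Q → T_p (TQ)` at `p = (q, v)`: the differential at `v` of the inclusion
`w ↦ (q, w)` of the fibre `T_q Q` into `TQ`. In natural coordinates `w ↦ wⁱ ∂/∂vⁱ`. -/
def verticalLift (p : TangentBundle 𝓘(ℝ, E) Q) :
    TangentSpace 𝓘(ℝ, E) p.proj →L[ℝ] TangentSpace 𝓘(ℝ, E).tangent p :=
  mfderiv 𝓘(ℝ, E) 𝓘(ℝ, E).tangent
    (fun w : E => (⟨p.proj, w⟩ : TangentBundle 𝓘(ℝ, E) Q)) p.snd

/-- The canonical tensor field `S = ∂/∂vⁱ ⊗ dqⁱ` on `TQ`: the vertical lift of the differential of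
the projection `TQ → Q`. -/
def verticalEndo (p : TangentBundle 𝓘(ℝ, E) Q) :
    TangentSpace 𝓘(ℝ, E).tangent p →L[ℝ] TangentSpace 𝓘(ℝ, E).tangent p :=
  (verticalLift p).comp
    (mfderiv 𝓘(ℝ, E).tangent 𝓘(ℝ, E)
      (fun x : TangentBundle 𝓘(ℝ, E) Q => x.proj) p)

/-- The dual `S*`, acting on covectors by `S* α = α ∘ S`. -/
def verticalEndoDual (p : TangentBundle 𝓘(ℝ, E) Q) :
    (TangentSpace 𝓘(ℝ, E).tangent p →L[ℝ] ℝ) →L[ℝ] (TangentSpace 𝓘(ℝ, E).tangent p →L[ℝ] ℝ) :=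
  ContinuousLinearMap.precomp ℝ (verticalEndo p)

/-- The Liouville vector field `Δ = vⁱ ∂/∂vⁱ` on `TQ`. -/
def liouville (p : TangentBundle 𝓘(ℝ, E) Q) : TangentSpace 𝓘(ℝ, E).tangent p :=
  verticalLift p p.snd

/-- The differential at `p` of a function on `TQ`. -/
def differential (f : TangentBundle 𝓘(ℝ, E) Q → ℝ) (p : TangentBundle 𝓘(ℝ, E) Q) :
    TangentSpace 𝓘(ℝ, E).tangent p →L[ℝ] ℝ :=
  mfderiv 𝓘(ℝ, E).tangent 𝓘(ℝ, ℝ) f p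

/-- The Poincaré–Cartan `1`-form `Θ_L = S* (dL)`. -/
def cartanOneForm (L : TangentBundle 𝓘(ℝ, E) Q → ℝ) (p : TangentBundle 𝓘(ℝ, E) Q) :
    TangentSpace 𝓘(ℝ, E).tangent p →L[ℝ] ℝ :=
  verticalEndoDual p (differential L p)

/-- The Cartan `2`-form `ω_L = - dΘ_L`. As a map `T_p (TQ) → T_p* (TQ)`, `u ↦ ω_L (u, ·)`, it is
the contraction map `ω̂_L`. -/
def cartanTwoForm (L : TangentBundle 𝓘(ℝ, E) Q → ℝ) (p : TangentBundle 𝓘(ℝ, E) Q) :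
    TangentSpace 𝓘(ℝ, E).tangent p →L[ℝ] TangentSpace 𝓘(ℝ, E).tangent p →L[ℝ] ℝ :=
  -extDerivOneForm 𝓘(ℝ, E).tangent (cartanOneForm L) p

/-- The energy `E_L = Δ (L) - L`. -/
def energy (L : TangentBundle 𝓘(ℝ, E) Q → ℝ) (p : TangentBundle 𝓘(ℝ, E) Q) : ℝ :=
  differential L p (liouville p) - L p

/-- `L` is regular: `ω_L` is nondegenerate, i.e. `ω̂_L` is an isomorphism at each point. -/
def IsRegular (L : TangentBundle 𝓘(ℝ, E) Q → ℝ) : Prop :=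
  ∀ p, (cartanTwoForm L p).IsInvertible

/-- The bundle map `T* (TQ) → T (TQ)` given by the Poisson tensor `Λ_L` of a regular Lagrangian,
namely `α ↦ ω̂_L⁻¹ (α)`, see `apply_poissonSharp`. -/
def poissonSharp (L : TangentBundle 𝓘(ℝ, E) Q → ℝ) (p : TangentBundle 𝓘(ℝ, E) Q) :
    (TangentSpace 𝓘(ℝ, E).tangent p →L[ℝ] ℝ) →L[ℝ] TangentSpace 𝓘(ℝ, E).tangent p :=
  (cartanTwoForm L p).inverse

/-- The Poisson tensor `Λ_L (α, β) = ω_L (ω̂_L⁻¹ α, ω̂_L⁻¹ β)`. -/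
def poissonTensor (L : TangentBundle 𝓘(ℝ, E) Q → ℝ) (p : TangentBundle 𝓘(ℝ, E) Q)
    (α β : TangentSpace 𝓘(ℝ, E).tangent p →L[ℝ] ℝ) : ℝ :=
  cartanTwoForm L p (poissonSharp L p α) (poissonSharp L p β)

theorem apply_poissonSharp {L : TangentBundle 𝓘(ℝ, E) Q → ℝ} (hL : IsRegular L)
    (p : TangentBundle 𝓘(ℝ, E) Q) (α β : TangentSpace 𝓘(ℝ, E).tangent p →L[ℝ] ℝ) :
    α (poissonSharp L p β) = poissonTensor L p α β := by
  have h : cartanTwoForm L p (poissonSharp L p α) = α :=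
    (((hL p).inverse_apply_eq).mp rfl).symm
  rw [poissonTensor, h]

/-- The Euler–Lagrange vector field `Γ_L` of a regular Lagrangian: the solution of
`i_{Γ_L} ω_L = dE_L`. -/
def eulerLagrangeField (L : TangentBundle 𝓘(ℝ, E) Q → ℝ) (p : TangentBundle 𝓘(ℝ, E) Q) :
    TangentSpace 𝓘(ℝ, E).tangent p :=
  poissonSharp L p (differential (energy L) p)

/-- The Hessian of `L`: the tensor `H_L (α, β) = Λ_L (S* α, β)` on `T* (TQ)`. -/
def hessian (L : TangentBundle 𝓘(ℝ, E) Q → ℝ) (p : TangentBundle 𝓘(ℝ, E) Q)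
    (α β : TangentSpace 𝓘(ℝ, E).tangent p →L[ℝ] ℝ) : ℝ :=
  poissonTensor L p (verticalEndoDual p α) β

/-- `L` is definite: it is regular and `H_L` is definite (positive or negative) at each point.
Horizontal covectors, those with `S* α = 0`, always lie in the kernel of `H_L`, so definiteness
means definiteness modulo horizontal covectors. -/
def IsDefinite (L : TangentBundle 𝓘(ℝ, E) Q → ℝ) : Prop :=
  IsRegular L ∧ ∀ p,
    (∀ α, verticalEndoDual p α ≠ 0 → 0 < hessian L p α α) ∨
      (∀ α, verticalEndoDual p α ≠ 0 → hessian L p α α < 0)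

end Lagrangian

section Constraints

variable {E : Type*} [NormedAddCommGroup E] [NormedSpace ℝ E]
  {Q : Type*} [TopologicalSpace Q] [ChartedSpace E Q] [IsManifold 𝓘(ℝ, E) ∞ Q]
  (G : Type*) [NormedAddCommGroup G] [NormedSpace ℝ G]
  {C : Type*} [TopologicalSpace C] [ChartedSpace G C]

/-- Smoothness on `U` of a vector field of `TQ` along `ι : C → TQ`, i.e. of a section of `T_C (TQ)`;
`G` is the model space of `C`. -/
def IsSmoothAlong (ι : C → TangentBundle 𝓘(ℝ, E) Q)
    (X : ∀ c, TangentSpace 𝓘(ℝ, E).tangent (ι c)) (U : Set C) : Prop :=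
  ContMDiffOn 𝓘(ℝ, G) 𝓘(ℝ, E).tangent.tangent ∞
    (fun c => (⟨ι c, X c⟩ :
      TangentBundle 𝓘(ℝ, E).tangent (TangentBundle 𝓘(ℝ, E) Q))) U

/-- `D` is a smooth vector subbundle of `T_C (TQ)`: near each point of `C` it has a smooth
frame. -/
def IsSubbundleAlong (ι : C → TangentBundle 𝓘(ℝ, E) Q)
    (D : ∀ c, Submodule ℝ (TangentSpace 𝓘(ℝ, E).tangent (ι c))) : Prop :=
  ∀ c₀ : C, ∃ U : Set C, IsOpen U ∧ c₀ ∈ U ∧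
    ∃ (k : ℕ) (X : Fin k → ∀ c, TangentSpace 𝓘(ℝ, E).tangent (ι c)),
      (∀ i, IsSmoothAlong G ι (X i) U) ∧
      ∀ c ∈ U, LinearIndependent ℝ (fun i => X i c) ∧
        Submodule.span ℝ (Set.range fun i => X i c) = D c

/-- The annihilator of a subspace of `T_p (TQ)` in `T_p* (TQ)`. -/
def annihilator {p : TangentBundle 𝓘(ℝ, E) Q}
    (W : Submodule ℝ (TangentSpace 𝓘(ℝ, E).tangent p)) :
    Submodule ℝ (TangentSpace 𝓘(ℝ, E).tangent p →L[ℝ] ℝ) where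
  carrier := {α | ∀ w ∈ W, α w = 0}
  add_mem' := fun {α β} hα hβ w hw => by simp [hα w hw, hβ w hw]
  zero_mem' := fun w _ => by simp
  smul_mem' := fun r α hα w hw => by simp [hα w hw]

/-- `D` is admissible: `S*` is injective on `D⁰`. -/
def IsAdmissible (ι : C → TangentBundle 𝓘(ℝ, E) Q)
    (D : ∀ c, Submodule ℝ (TangentSpace 𝓘(ℝ, E).tangent (ι c))) : Prop :=
  ∀ c, Set.InjOn (verticalEndoDual (ι c)) (annihilator (D c))

/-- Chetaev's bundle of reaction forces `F = S* (D⁰)`. -/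
def chetaevForces (ι : C → TangentBundle 𝓘(ℝ, E) Q)
    (D : ∀ c, Submodule ℝ (TangentSpace 𝓘(ℝ, E).tangent (ι c))) (c : C) :
    Submodule ℝ (TangentSpace 𝓘(ℝ, E).tangent (ι c) →L[ℝ] ℝ) :=
  (annihilator (D c)).map (verticalEndoDual (ι c)).toLinearMap

/-- `Γ` solves the non-holonomic Lagrangian problem `(L, C, D, F)`: it is a smooth vector field
along `C`, of the form `Γ ∈ Γ_L + Λ_L (F)`, and contained in `D`. -/
structure IsSolution (L : TangentBundle 𝓘(ℝ, E) Q → ℝ) (ι : C → TangentBundle 𝓘(ℝ, E) Q)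
    (D : ∀ c, Submodule ℝ (TangentSpace 𝓘(ℝ, E).tangent (ι c)))
    (F : ∀ c, Submodule ℝ (TangentSpace 𝓘(ℝ, E).tangent (ι c) →L[ℝ] ℝ))
    (Γ : ∀ c, TangentSpace 𝓘(ℝ, E).tangent (ι c)) : Prop where
  smooth : IsSmoothAlong G ι Γ Set.univ
  mem_affine : ∀ c, ∃ f ∈ F c, Γ c = eulerLagrangeField L (ι c) + poissonSharp L (ι c) f
  mem_permitted : ∀ c, Γ c ∈ D c

/-- `Γ` is a second order differential equation (SODE) along `C`: `S (Γ) = Δ`. -/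
def IsSODE (ι : C → TangentBundle 𝓘(ℝ, E) Q)
    (Γ : ∀ c, TangentSpace 𝓘(ℝ, E).tangent (ι c)) : Prop :=
  ∀ c, verticalEndo (ι c) (Γ c) = liouville (ι c)

end Constraints

end Nonholonomic

end

/-!
A vector `X` at `c ∈ C` lies in `Γ_L + Λ_L (S* (D⁰))` exactly when `i_X ω_L = dE_L + S* α` for some
`α ∈ D⁰`, so the problem is to solve this equation for `X ∈ D` and `α ∈ D⁰`.

*Uniqueness.* The difference `w ∈ D` of two solutions satisfies `i_w ω_L = S* α` with `α ∈ D⁰`.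
Then `H_L (α, α) = - α (w) = 0`, so `S* α = 0` because `L` is definite, and `w = 0` by regularity;
moreover `α = 0` by admissibility (`eq_zero_of_cartanTwoForm_eq_verticalEndoDual`).

*Existence and smoothness.* In a smooth local frame `X₁, …, X_k` of `D` the equation becomes the
linear system `ω_L (∑ aᵢ Xᵢ) - S* α = dE_L`, `α (Xᵢ) = 0`, with unknowns `a ∈ ℝᵏ` and `α` in the
whole cotangent space. It has as many equations as unknowns and, by the uniqueness argument, no
kernel. In natural coordinates its entries are smooth, hence so is its solution
(`exists_smooth_local_solution`). Smoothness of the entries requires the coordinate expression of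
`ω_L` in one fixed chart, hence the independence of the exterior derivative from the chart
(`extDerivOneForm_eq_fderiv_oneFormInChart`).

*Second order.* From `ω_L (S u, v) = - ω_L (u, S v)`, `dE_L ∘ S = - i_Δ ω_L` and `S² = 0`, every
solution of `i_X ω_L = dE_L + S* α` satisfies `S (X) = Δ` (`verticalEndo_eq_liouville`), so
Chetaev's reaction forces preserve the SODE property.
-/

noncomputable section

namespace Nonholonomic

/-! ### Exterior derivatives in an arbitrary chart -/

section ChartInvariance

open Filter Topology

theorem fderiv_fderiv_symm {F K : Type*} [NormedAddCommGroup F] [NormedSpace ℝ F]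
    [NormedAddCommGroup K] [NormedSpace ℝ K] {f : F → K} {x : F} (hf : ContDiffAt ℝ ∞ f x)
    (a b : F) : fderiv ℝ (fderiv ℝ f) x a b = fderiv ℝ (fderiv ℝ f) x b a :=
  (hf.isSymmSndFDerivAt (by
    simpa using! (WithTop.coe_le_coe.2 le_top : ((2 : ℕ∞) : WithTop ℕ∞) ≤ ∞))).eq a b

variable {V H M : Type*} [NormedAddCommGroup V] [NormedSpace ℝ V] [TopologicalSpace H]
  (J : ModelWithCorners ℝ V H) [TopologicalSpace M] [ChartedSpace H M]

theorem mdifferentiableAt_extChartAt_symm [J.Boundaryless] [IsManifold J 1 M] {p : M} {y : V}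
    (hy : y ∈ (extChartAt J p).target) :
    MDifferentiableAt 𝓘(ℝ, V) J (extChartAt J p).symm y := by
  have h := mdifferentiableWithinAt_extChartAt_symm (I := J) hy
  rwa [J.range_eq_univ, mdifferentiableWithinAt_univ] at h

/-- The local representatives of a `1`-form in two charts differ by the pull-back along the
transition map. -/
theorem oneFormInChart_eventuallyEq [J.Boundaryless] [IsManifold J 1 M]
    (θ : ∀ x : M, TangentSpace J x →L[ℝ] ℝ) {p₀ p : M} (hp : p ∈ (extChartAt J p₀).source) :
    oneFormInChart J θ p =ᶠ[𝓝 (extChartAt J p p)] fun y =>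
      (oneFormInChart J θ p₀ ((extChartAt J p₀ ∘ (extChartAt J p).symm) y)).comp
        (fderiv ℝ (extChartAt J p₀ ∘ (extChartAt J p).symm) y) := by
  have h1 : ∀ᶠ y in 𝓝 (extChartAt J p p), y ∈ (extChartAt J p).target :=
    extChartAt_target_mem_nhds (I := J) p
  have h2 : ∀ᶠ y in 𝓝 (extChartAt J p p), (extChartAt J p).symm y ∈ (extChartAt J p₀).source := by
    have hc : ContinuousAt (extChartAt J p).symm (extChartAt J p p) :=
      continuousAt_extChartAt_symm (I := J) p
    refine hc.preimage_mem_nhds ?_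
    rw [extChartAt_to_inv]
    exact extChartAt_source_mem_nhds' (I := J) hp
  filter_upwards [h1, h2.eventually_nhds] with y hy1 hy2
  have hs : MDifferentiableAt 𝓘(ℝ, V) J (extChartAt J p).symm y :=
    mdifferentiableAt_extChartAt_symm J hy1
  have hφ : MDifferentiableAt J 𝓘(ℝ, V) (extChartAt J p₀) ((extChartAt J p).symm y) :=
    mdifferentiableAt_extChartAt (by simpa using hy2.self_of_nhds)
  have hτ : MDifferentiableAt 𝓘(ℝ, V) 𝓘(ℝ, V) (extChartAt J p₀ ∘ (extChartAt J p).symm) y :=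
    hφ.comp y hs
  have hs0 : MDifferentiableAt 𝓘(ℝ, V) J (extChartAt J p₀).symm
      ((extChartAt J p₀ ∘ (extChartAt J p).symm) y) :=
    mdifferentiableAt_extChartAt_symm J ((extChartAt J p₀).map_source hy2.self_of_nhds)
  have heq : (extChartAt J p).symm =ᶠ[𝓝 y]
      (extChartAt J p₀).symm ∘ (extChartAt J p₀ ∘ (extChartAt J p).symm) := by
    filter_upwards [hy2] with z hz
    exact ((extChartAt J p₀).left_inv hz).symm
  have hpt : (extChartAt J p₀).symm ((extChartAt J p₀ ∘ (extChartAt J p).symm) y) =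
      (extChartAt J p).symm y := (extChartAt J p₀).left_inv hy2.self_of_nhds
  have key := heq.mfderiv_eq (I := 𝓘(ℝ, V)) (I' := J)
  rw [mfderiv_comp y hs0 hτ, mfderiv_eq_fderiv] at key
  have hθ : (θ ((extChartAt J p).symm y) : V →L[ℝ] ℝ) =
    θ ((extChartAt J p₀).symm ((extChartAt J p₀ ∘ (extChartAt J p).symm) y)) := by rw [hpt]
  have := congrArg₂ (fun (a : V →L[ℝ] ℝ) (b : V →L[ℝ] V) => a.comp b) hθ key
  exact this

/-- `dθ` at `p`, which is defined in the chart at `p`, can be computed in any chart around `p`: the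
second derivative of the transition map is symmetric and drops out of the skew-symmetrization. This
is what makes `dθ` accessible to smoothness arguments, where `p` varies and the chart is fixed. -/
theorem extDerivOneForm_eq_fderiv_oneFormInChart [J.Boundaryless] [IsManifold J ∞ M]
    (θ : ∀ x : M, TangentSpace J x →L[ℝ] ℝ) {p₀ p : M} (hp : p ∈ (extChartAt J p₀).source)
    (hθ : DifferentiableAt ℝ (oneFormInChart J θ p₀) (extChartAt J p₀ p))
    (u v : TangentSpace J p) :
    extDerivOneForm J θ p u v =
      fderiv ℝ (oneFormInChart J θ p₀) (extChartAt J p₀ p)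
          (mfderiv J 𝓘(ℝ, V) (extChartAt J p₀) p u) (mfderiv J 𝓘(ℝ, V) (extChartAt J p₀) p v) -
        fderiv ℝ (oneFormInChart J θ p₀) (extChartAt J p₀ p)
          (mfderiv J 𝓘(ℝ, V) (extChartAt J p₀) p v)
          (mfderiv J 𝓘(ℝ, V) (extChartAt J p₀) p u) := by
  have : IsManifold J 1 M := .of_le (n := ∞) (by simp)
  set τ : V → V := extChartAt J p₀ ∘ (extChartAt J p).symm
  set y : V := extChartAt J p p with hy
  have hsy : (extChartAt J p).symm y = p := extChartAt_to_inv (I := J) p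
  have hτy : τ y = extChartAt J p₀ p := congrArg (extChartAt J p₀) hsy
  have hs : ContMDiffAt 𝓘(ℝ, V) J ∞ (extChartAt J p).symm y := by
    have h := contMDiffWithinAt_extChartAt_symm_range (I := J) (n := ∞) p
      (mem_extChartAt_target (I := J) p)
    rwa [J.range_eq_univ, contMDiffWithinAt_univ] at h
  have hφ : ContMDiffAt J 𝓘(ℝ, V) ∞ (extChartAt J p₀) p :=
    contMDiffAt_extChartAt' (by simpa using hp)
  have hτ : ContDiffAt ℝ ∞ τ y := by
    refine ContMDiffAt.contDiffAt ?_
    refine ContMDiffAt.comp (I' := J) y ?_ hs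
    rw [hsy]; exact hφ
  -- The differential of `τ` at `y` is the change of coordinates on `T_p M`.
  have hd : ∀ w : TangentSpace J p, fderiv ℝ τ y (mfderiv J 𝓘(ℝ, V) (extChartAt J p) p w) =
      mfderiv J 𝓘(ℝ, V) (extChartAt J p₀) p w := by
    intro w
    have h1 : τ ∘ extChartAt J p =ᶠ[𝓝 p] extChartAt J p₀ := by
      filter_upwards [extChartAt_source_mem_nhds (I := J) p] with q hq
      exact congrArg (extChartAt J p₀) ((extChartAt J p).left_inv hq)
    have h2 := h1.mfderiv_eq (I := J) (I' := 𝓘(ℝ, V))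
    rw [mfderiv_comp p (I' := 𝓘(ℝ, V)) ((hτ.differentiableAt (by simp)).mdifferentiableAt)
      (mdifferentiableAt_extChartAt (mem_chart_source H p)), mfderiv_eq_fderiv] at h2
    exact congrArg (fun a : V →L[ℝ] V => a w) h2
  have hτ' : HasFDerivAt (fderiv ℝ τ) (fderiv ℝ (fderiv ℝ τ) y) y :=
    ((hτ.fderiv_right (m := 1) (by norm_cast)).differentiableAt (by simp)).hasFDerivAt
  have hτ1 : HasFDerivAt τ (fderiv ℝ τ y) y := (hτ.differentiableAt (by simp)).hasFDerivAt
  have hθ' : HasFDerivAt (oneFormInChart J θ p₀)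
      (fderiv ℝ (oneFormInChart J θ p₀) (τ y)) (τ y) := by
    rw [hτy]; exact hθ.hasFDerivAt
  have hsymm := fderiv_fderiv_symm hτ
  have hprod := (hθ'.comp y hτ1).clm_comp hτ'
  have hfd : fderiv ℝ (oneFormInChart J θ p) y = _ :=
    ((oneFormInChart_eventuallyEq J θ hp).fderiv_eq).trans hprod.fderiv
  have hskew : ∀ a b : V,
      fderiv ℝ (oneFormInChart J θ p) y a b - fderiv ℝ (oneFormInChart J θ p) y b a =
      fderiv ℝ (oneFormInChart J θ p₀) (τ y) (fderiv ℝ τ y a) (fderiv ℝ τ y b) -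
        fderiv ℝ (oneFormInChart J θ p₀) (τ y) (fderiv ℝ τ y b) (fderiv ℝ τ y a) := by
    intro a b
    rw [hfd]
    simp [hsymm a b]
  rw [extDerivOneForm_apply, ← hτy]
  exact (hskew _ _).trans (congrArg₂ (fun a b : V =>
    fderiv ℝ (oneFormInChart J θ p₀) (τ y) a b - fderiv ℝ (oneFormInChart J θ p₀) (τ y) b a)
    (hd u) (hd v))

/-- The trivialization of the tangent bundle at `x₀` is the differential of the chart at `x₀`. -/
theorem snd_trivializationAt_tangentSpace [IsManifold J 1 M] {x₀ : M} {z : TangentBundle J M}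
    (hz : z.proj ∈ (chartAt H x₀).source) :
    (trivializationAt V (TangentSpace J : M → Type _) x₀ z).2 =
      (mfderiv J 𝓘(ℝ, V) (extChartAt J x₀) z.proj z.snd : V) := by
  have h := Bundle.Trivialization.continuousLinearMapAt_apply_of_mem (R := ℝ)
    (trivializationAt V (TangentSpace J : M → Type _) x₀) (b := z.proj) hz z.snd
  exact h.symm.trans
    (congrArg (fun g : TangentSpace J z.proj →L[ℝ] V => g z.snd)
      (TangentBundle.continuousLinearMapAt_trivializationAt hz))

end ChartInvariance

/-! ### Natural coordinates on the tangent bundle -/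

section TangentCharts

open Filter Topology

variable {E : Type*} [NormedAddCommGroup E] [NormedSpace ℝ E]
  {Q : Type*} [TopologicalSpace Q] [ChartedSpace E Q] [IsManifold 𝓘(ℝ, E) ∞ Q]

theorem mem_extChartAt_tangent_source {p₀ p : TangentBundle 𝓘(ℝ, E) Q} :
    p ∈ (extChartAt 𝓘(ℝ, E).tangent p₀).source ↔ p.proj ∈ (chartAt E p₀.proj).source := by
  rw [extChartAt_source, TangentBundle.mem_chart_source_iff]

/-- The natural chart of `TQ` induced by a chart `ψ` of `Q` is `(q, v) ↦ (ψ q, dψ_q v)`. -/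
theorem extChartAt_tangent_apply {p₀ p : TangentBundle 𝓘(ℝ, E) Q}
    (hp : p ∈ (extChartAt 𝓘(ℝ, E).tangent p₀).source) :
    extChartAt 𝓘(ℝ, E).tangent p₀ p =
      (extChartAt 𝓘(ℝ, E) p₀.proj p.proj,
        (mfderiv 𝓘(ℝ, E) 𝓘(ℝ, E) (extChartAt 𝓘(ℝ, E) p₀.proj) p.proj p.snd : E)) := by
  have : IsManifold 𝓘(ℝ, E) 1 Q := .of_le (n := ∞) (by simp)
  have hp' := mem_extChartAt_tangent_source.1 hp
  rw [FiberBundle.extChartAt]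
  exact congrArg (Prod.mk (extChartAt 𝓘(ℝ, E) p₀.proj p.proj))
    (snd_trivializationAt_tangentSpace 𝓘(ℝ, E) hp')

/-- The differential at `p` of the natural chart of `TQ` around `p₀`: the components in `E × E` of
a vector tangent to `TQ` at `p`. -/
def chartDifferential (p₀ p : TangentBundle 𝓘(ℝ, E) Q) :
    TangentSpace 𝓘(ℝ, E).tangent p →L[ℝ] E × E :=
  mfderiv 𝓘(ℝ, E).tangent 𝓘(ℝ, E × E) (extChartAt 𝓘(ℝ, E).tangent p₀) p

theorem mdifferentiableAt_fiberInclusion (p : TangentBundle 𝓘(ℝ, E) Q) :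
    MDifferentiableAt 𝓘(ℝ, E) 𝓘(ℝ, E).tangent
      (fun w : E => (⟨p.proj, w⟩ : TangentBundle 𝓘(ℝ, E) Q)) p.snd := by
  refine (mdifferentiableAt_totalSpace 𝓘(ℝ, E) (F := E) (E := (TangentSpace 𝓘(ℝ, E) : Q → Type _))
    (fun w : E => (⟨p.proj, w⟩ : TangentBundle 𝓘(ℝ, E) Q))
    (x₀ := p.snd)).2 ⟨mdifferentiableAt_const, ?_⟩
  have : IsManifold 𝓘(ℝ, E) 1 Q := .of_le (n := ∞) (by simp)
  let T : E →L[ℝ] E := mfderiv 𝓘(ℝ, E) 𝓘(ℝ, E) (extChartAt 𝓘(ℝ, E) p.proj) p.proj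
  have hT : (fun w : E => (trivializationAt E (TangentSpace 𝓘(ℝ, E) : Q → Type _) p.proj
      (⟨p.proj, w⟩ : TangentBundle 𝓘(ℝ, E) Q)).2) = T :=
    funext fun w => snd_trivializationAt_tangentSpace 𝓘(ℝ, E) (z := ⟨p.proj, w⟩)
      (mem_chart_source E p.proj)
  exact (congrArg (fun g : E → E => MDifferentiableAt 𝓘(ℝ, E) 𝓘(ℝ, E) g p.snd) hT).mpr
    T.differentiableAt.mdifferentiableAt

theorem mdifferentiableAt_extChartAt_tangent {p₀ p : TangentBundle 𝓘(ℝ, E) Q}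
    (hp : p ∈ (extChartAt 𝓘(ℝ, E).tangent p₀).source) :
    MDifferentiableAt 𝓘(ℝ, E).tangent 𝓘(ℝ, E × E) (extChartAt 𝓘(ℝ, E).tangent p₀) p := by
  have : IsManifold 𝓘(ℝ, E).tangent 1 (TangentBundle 𝓘(ℝ, E) Q) := .of_le (n := ∞) (by simp)
  exact mdifferentiableAt_extChartAt (by simpa using hp)

/-- In natural coordinates the vertical lift is `a ↦ (0, a)`, because the natural charts are linear
on the fibres of `TQ`. -/
theorem chartDifferential_verticalLift {p₀ p : TangentBundle 𝓘(ℝ, E) Q}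
    (hp : p ∈ (extChartAt 𝓘(ℝ, E).tangent p₀).source) (a : TangentSpace 𝓘(ℝ, E) p.proj) :
    chartDifferential p₀ p (verticalLift p a) =
      ((0 : E), (mfderiv 𝓘(ℝ, E) 𝓘(ℝ, E) (extChartAt 𝓘(ℝ, E) p₀.proj) p.proj a : E)) := by
  set T : E →L[ℝ] E := mfderiv 𝓘(ℝ, E) 𝓘(ℝ, E) (extChartAt 𝓘(ℝ, E) p₀.proj) p.proj
  have h1 : extChartAt 𝓘(ℝ, E).tangent p₀ ∘
      (fun w : E => (⟨p.proj, w⟩ : TangentBundle 𝓘(ℝ, E) Q)) =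
      fun w : E => (extChartAt 𝓘(ℝ, E) p₀.proj p.proj, T w) := by
    ext1 w
    exact extChartAt_tangent_apply (p := ⟨p.proj, w⟩)
      (mem_extChartAt_tangent_source.2 (mem_extChartAt_tangent_source.1 hp))
  have h2 := mfderiv_comp (I := 𝓘(ℝ, E)) (I' := 𝓘(ℝ, E).tangent) (I'' := 𝓘(ℝ, E × E))
    (g := extChartAt 𝓘(ℝ, E).tangent p₀)
    (f := fun w : E => (⟨p.proj, w⟩ : TangentBundle 𝓘(ℝ, E) Q)) (p.snd : E)
    (mdifferentiableAt_extChartAt_tangent hp) (mdifferentiableAt_fiberInclusion p)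
  have h3 : HasFDerivAt (fun w : E => (extChartAt 𝓘(ℝ, E) p₀.proj p.proj, T w))
      ((0 : E →L[ℝ] E).prod T) (p.snd : E) :=
    (hasFDerivAt_const _ _).prodMk T.hasFDerivAt
  rw [h1] at h2
  exact ((congrArg (fun g : E →L[ℝ] E × E => g a) h2).symm.trans
    (congrArg (fun g : E →L[ℝ] E × E => g a) h3.hasMFDerivAt.mfderiv))

/-- In natural coordinates the differential of `TQ → Q` is `(a, b) ↦ a`. -/
theorem fst_chartDifferential {p₀ p : TangentBundle 𝓘(ℝ, E) Q}
    (hp : p ∈ (extChartAt 𝓘(ℝ, E).tangent p₀).source) (u : TangentSpace 𝓘(ℝ, E).tangent p) :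
    (chartDifferential p₀ p u).1 =
      (mfderiv 𝓘(ℝ, E) 𝓘(ℝ, E) (extChartAt 𝓘(ℝ, E) p₀.proj) p.proj
        (mfderiv 𝓘(ℝ, E).tangent 𝓘(ℝ, E) (fun x : TangentBundle 𝓘(ℝ, E) Q => x.proj) p u) : E) := by
  have : IsManifold 𝓘(ℝ, E) 1 Q := .of_le (n := ∞) (by simp)
  have h1 : (ContinuousLinearMap.fst ℝ E E) ∘ extChartAt 𝓘(ℝ, E).tangent p₀ =ᶠ[𝓝 p]
      extChartAt 𝓘(ℝ, E) p₀.proj ∘ fun x : TangentBundle 𝓘(ℝ, E) Q => x.proj := by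
    filter_upwards [extChartAt_source_mem_nhds' (I := 𝓘(ℝ, E).tangent) hp] with x hx
    exact congrArg Prod.fst (extChartAt_tangent_apply hx)
  have h2 := h1.mfderiv_eq (I := 𝓘(ℝ, E).tangent) (I' := 𝓘(ℝ, E))
  have hproj : MDifferentiableAt 𝓘(ℝ, E).tangent 𝓘(ℝ, E)
      (fun x : TangentBundle 𝓘(ℝ, E) Q => x.proj) p :=
    (Bundle.contMDiffAt_proj (n := 1) (TangentSpace 𝓘(ℝ, E) : Q → Type _)).mdifferentiableAt
      one_ne_zero
  rw [mfderiv_comp (I' := 𝓘(ℝ, E × E)) p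
      (ContinuousLinearMap.differentiableAt _).mdifferentiableAt
      (mdifferentiableAt_extChartAt_tangent hp),
    mfderiv_comp (I' := 𝓘(ℝ, E)) p
      (mdifferentiableAt_extChartAt (mem_extChartAt_tangent_source.1 hp)) hproj,
    mfderiv_eq_fderiv, ContinuousLinearMap.fderiv] at h2
  exact congrArg (fun g : E × E →L[ℝ] E => g u) h2

/-- In natural coordinates `S (a, b) = (0, a)`. -/
theorem chartDifferential_verticalEndo {p₀ p : TangentBundle 𝓘(ℝ, E) Q}
    (hp : p ∈ (extChartAt 𝓘(ℝ, E).tangent p₀).source) (u : TangentSpace 𝓘(ℝ, E).tangent p) :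
    chartDifferential p₀ p (verticalEndo p u) =
      ((0 : E), (chartDifferential p₀ p u).1) := by
  exact (chartDifferential_verticalLift hp _).trans
    (congrArg (Prod.mk (0 : E)) (fst_chartDifferential hp u).symm)

/-- In natural coordinates `Δ (x, v) = (0, v)`. -/
theorem chartDifferential_liouville {p₀ p : TangentBundle 𝓘(ℝ, E) Q}
    (hp : p ∈ (extChartAt 𝓘(ℝ, E).tangent p₀).source) :
    chartDifferential p₀ p (liouville p) =
      ((0 : E), (extChartAt 𝓘(ℝ, E).tangent p₀ p).2) := by
  exact (chartDifferential_verticalLift hp _).trans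
    (congrArg (fun z : E × E => ((0 : E), z.2)) (extChartAt_tangent_apply hp)).symm

end TangentCharts

/-! ### The Cartan form and the energy in natural coordinates -/

section LagrangianInCoordinates

open Filter Topology

variable {E : Type*} [NormedAddCommGroup E] [NormedSpace ℝ E]

theorem contDiff_continuousLinearMap_flip {F G K : Type*} [NormedAddCommGroup F]
    [NormedSpace ℝ F] [NormedAddCommGroup G] [NormedSpace ℝ G] [NormedAddCommGroup K]
    [NormedSpace ℝ K] : ContDiff ℝ ∞ (fun f : F →L[ℝ] G →L[ℝ] K => f.flip) :=
  IsBoundedLinearMap.contDiff ⟨⟨fun _ _ => rfl, fun _ _ => rfl⟩, 1, one_pos, fun f => by simp⟩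

/-- The vertical endomorphism `(a, b) ↦ (0, a)` in natural coordinates. -/
def modelVerticalEndo (E : Type*) [NormedAddCommGroup E] [NormedSpace ℝ E] : E × E →L[ℝ] E × E :=
  (ContinuousLinearMap.inr ℝ E E).comp (ContinuousLinearMap.fst ℝ E E)

/-- The Liouville vector field `(x, v) ↦ (0, v)` in natural coordinates. -/
def modelLiouville (E : Type*) [NormedAddCommGroup E] [NormedSpace ℝ E] : E × E →L[ℝ] E × E :=
  (ContinuousLinearMap.inr ℝ E E).comp (ContinuousLinearMap.snd ℝ E E)

@[simp]
theorem modelVerticalEndo_apply (a : E × E) : modelVerticalEndo E a = (0, a.1) := rfl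

@[simp]
theorem modelLiouville_apply (a : E × E) : modelLiouville E a = (0, a.2) := rfl

/-- The Cartan `2`-form in natural coordinates, for the coordinate expression `l` of the
Lagrangian: `(a, b) ↦ D²l (b, S a) - D²l (a, S b)`. -/
def modelCartanTwoForm (l : E × E → ℝ) (y : E × E) : E × E →L[ℝ] E × E →L[ℝ] ℝ :=
  ((ContinuousLinearMap.precomp ℝ (modelVerticalEndo E)).comp (fderiv ℝ (fderiv ℝ l) y)).flip -
    (ContinuousLinearMap.precomp ℝ (modelVerticalEndo E)).comp (fderiv ℝ (fderiv ℝ l) y)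

theorem modelCartanTwoForm_apply (l : E × E → ℝ) (y a b : E × E) :
    modelCartanTwoForm l y a b =
      fderiv ℝ (fderiv ℝ l) y b (modelVerticalEndo E a) -
        fderiv ℝ (fderiv ℝ l) y a (modelVerticalEndo E b) := rfl

/-- The energy `Δ (l) - l` in natural coordinates, for the coordinate expression `l` of the
Lagrangian. -/
def modelEnergy (l : E × E → ℝ) (y : E × E) : ℝ :=
  fderiv ℝ l y (modelLiouville E y) - l y

theorem contDiffAt_modelEnergy {l : E × E → ℝ} {y : E × E} (hl : ContDiffAt ℝ ∞ l y) :
    ContDiffAt ℝ ∞ (modelEnergy l) y :=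
  ((hl.fderiv_right (m := ∞) (by simp)).clm_apply
    (modelLiouville E).contDiff.contDiffAt).sub hl

theorem contDiffAt_modelCartanTwoForm {l : E × E → ℝ} {y : E × E} (hl : ContDiffAt ℝ ∞ l y) :
    ContDiffAt ℝ ∞ (modelCartanTwoForm l) y := by
  have h0 : ContDiffAt ℝ ∞ (fderiv ℝ (fderiv ℝ l)) y :=
    (hl.fderiv_right (m := ∞) (by simp)).fderiv_right (m := ∞) (by simp)
  have h1 : ContDiffAt ℝ ∞ (fun z =>
      (ContinuousLinearMap.precomp ℝ (modelVerticalEndo E)).comp (fderiv ℝ (fderiv ℝ l) z)) y :=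
    contDiffAt_const.clm_comp h0
  have h2 : ContDiffAt ℝ ∞ (fun z => ((ContinuousLinearMap.precomp ℝ (modelVerticalEndo E)).comp
      (fderiv ℝ (fderiv ℝ l) z)).flip) y :=
    contDiff_continuousLinearMap_flip.contDiffAt.comp y h1
  exact h2.sub h1

theorem fderiv_modelEnergy {l : E × E → ℝ} {y : E × E} (hl : ContDiffAt ℝ ∞ l y) (a : E × E) :
    fderiv ℝ (modelEnergy l) y a = fderiv ℝ (fderiv ℝ l) y a (modelLiouville E y) +
      fderiv ℝ l y (modelLiouville E a) - fderiv ℝ l y a := by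
  have h1 : HasFDerivAt (fderiv ℝ l) (fderiv ℝ (fderiv ℝ l) y) y :=
    ((hl.fderiv_right (m := 1) (by norm_cast)).differentiableAt (by simp)).hasFDerivAt
  have h2 : HasFDerivAt l (fderiv ℝ l y) y := (hl.differentiableAt (by simp)).hasFDerivAt
  have h3 := (h1.clm_apply (modelLiouville E).hasFDerivAt).sub h2
  have h4 : fderiv ℝ (modelEnergy l) y = _ := h3.fderiv
  rw [h4]
  simp
  ring

variable {Q : Type*} [TopologicalSpace Q] [ChartedSpace E Q] [IsManifold 𝓘(ℝ, E) ∞ Q]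

/-- The coordinate expression, in the natural chart at `p₀`, of a function on `TQ`. -/
def funInChart (f : TangentBundle 𝓘(ℝ, E) Q → ℝ) (p₀ : TangentBundle 𝓘(ℝ, E) Q) : E × E → ℝ :=
  f ∘ (extChartAt 𝓘(ℝ, E).tangent p₀).symm

theorem funInChart_extChartAt (f : TangentBundle 𝓘(ℝ, E) Q → ℝ)
    {p₀ p : TangentBundle 𝓘(ℝ, E) Q} (hp : p ∈ (extChartAt 𝓘(ℝ, E).tangent p₀).source) :
    funInChart f p₀ (extChartAt 𝓘(ℝ, E).tangent p₀ p) = f p :=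
  congrArg f ((extChartAt 𝓘(ℝ, E).tangent p₀).left_inv hp)

theorem contDiffAt_funInChart {L : TangentBundle 𝓘(ℝ, E) Q → ℝ}
    (hL : ContMDiff 𝓘(ℝ, E).tangent 𝓘(ℝ, ℝ) ∞ L) (p₀ : TangentBundle 𝓘(ℝ, E) Q) {y : E × E}
    (hy : y ∈ (extChartAt 𝓘(ℝ, E).tangent p₀).target) :
    ContDiffAt ℝ ∞ (funInChart L p₀) y := by
  have h := contMDiffWithinAt_extChartAt_symm_range (I := 𝓘(ℝ, E).tangent) (n := ∞) p₀ hy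
  rw [ModelWithCorners.range_eq_univ, contMDiffWithinAt_univ] at h
  exact ContMDiffAt.contDiffAt (hL.contMDiffAt.comp y h)

/-- If `g` expresses `f` near `p` in the natural chart at `p₀`, then `df = dg ∘ dφ`. -/
theorem differential_eq_fderiv {f : TangentBundle 𝓘(ℝ, E) Q → ℝ} {g : E × E → ℝ}
    {p₀ p : TangentBundle 𝓘(ℝ, E) Q} (hp : p ∈ (extChartAt 𝓘(ℝ, E).tangent p₀).source)
    (hfg : f =ᶠ[𝓝 p] g ∘ extChartAt 𝓘(ℝ, E).tangent p₀)
    (hg : DifferentiableAt ℝ g (extChartAt 𝓘(ℝ, E).tangent p₀ p))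
    (u : TangentSpace 𝓘(ℝ, E).tangent p) :
    differential f p u = fderiv ℝ g (extChartAt 𝓘(ℝ, E).tangent p₀ p)
      (chartDifferential p₀ p u) := by
  have h := hfg.mfderiv_eq (I := 𝓘(ℝ, E).tangent) (I' := 𝓘(ℝ, ℝ))
  rw [mfderiv_comp (I' := 𝓘(ℝ, E × E)) p hg.mdifferentiableAt
    (mdifferentiableAt_extChartAt_tangent hp), mfderiv_eq_fderiv] at h
  exact congrArg (fun g : E × E →L[ℝ] ℝ => g u) h

variable {L : TangentBundle 𝓘(ℝ, E) Q → ℝ}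

theorem differential_eq_fderiv_funInChart (hL : ContMDiff 𝓘(ℝ, E).tangent 𝓘(ℝ, ℝ) ∞ L)
    {p₀ p : TangentBundle 𝓘(ℝ, E) Q} (hp : p ∈ (extChartAt 𝓘(ℝ, E).tangent p₀).source)
    (u : TangentSpace 𝓘(ℝ, E).tangent p) :
    differential L p u = fderiv ℝ (funInChart L p₀) (extChartAt 𝓘(ℝ, E).tangent p₀ p)
      (chartDifferential p₀ p u) := by
  refine differential_eq_fderiv hp ?_ ((contDiffAt_funInChart hL p₀
    ((extChartAt 𝓘(ℝ, E).tangent p₀).map_source hp)).differentiableAt (by simp)) u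
  filter_upwards [extChartAt_source_mem_nhds' (I := 𝓘(ℝ, E).tangent) hp] with x hx
  exact (funInChart_extChartAt L hx).symm

theorem energy_eq_modelEnergy (hL : ContMDiff 𝓘(ℝ, E).tangent 𝓘(ℝ, ℝ) ∞ L)
    {p₀ p : TangentBundle 𝓘(ℝ, E) Q} (hp : p ∈ (extChartAt 𝓘(ℝ, E).tangent p₀).source) :
    energy L p = modelEnergy (funInChart L p₀) (extChartAt 𝓘(ℝ, E).tangent p₀ p) := by
  unfold energy modelEnergy
  rw [funInChart_extChartAt L hp, differential_eq_fderiv_funInChart hL hp]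
  exact congrArg (fun a : E × E =>
    fderiv ℝ (funInChart L p₀) (extChartAt 𝓘(ℝ, E).tangent p₀ p) a - L p)
    (chartDifferential_liouville hp)

theorem differential_energy_eq_fderiv (hL : ContMDiff 𝓘(ℝ, E).tangent 𝓘(ℝ, ℝ) ∞ L)
    {p₀ p : TangentBundle 𝓘(ℝ, E) Q} (hp : p ∈ (extChartAt 𝓘(ℝ, E).tangent p₀).source)
    (u : TangentSpace 𝓘(ℝ, E).tangent p) :
    differential (energy L) p u =
      fderiv ℝ (modelEnergy (funInChart L p₀)) (extChartAt 𝓘(ℝ, E).tangent p₀ p)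
        (chartDifferential p₀ p u) := by
  refine differential_eq_fderiv hp ?_ ((contDiffAt_modelEnergy (contDiffAt_funInChart hL p₀
    ((extChartAt 𝓘(ℝ, E).tangent p₀).map_source hp))).differentiableAt (by simp)) u
  filter_upwards [extChartAt_source_mem_nhds' (I := 𝓘(ℝ, E).tangent) hp] with x hx
  exact energy_eq_modelEnergy hL hx

theorem oneFormInChart_cartanOneForm (hL : ContMDiff 𝓘(ℝ, E).tangent 𝓘(ℝ, ℝ) ∞ L)
    {p₀ : TangentBundle 𝓘(ℝ, E) Q} {y : E × E}
    (hy : y ∈ (extChartAt 𝓘(ℝ, E).tangent p₀).target) :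
    oneFormInChart 𝓘(ℝ, E).tangent (cartanOneForm L) p₀ y =
      (fderiv ℝ (funInChart L p₀) y).comp (modelVerticalEndo E) := by
  have : IsManifold 𝓘(ℝ, E).tangent 1 (TangentBundle 𝓘(ℝ, E) Q) := .of_le (n := ∞) (by simp)
  have hp := (extChartAt 𝓘(ℝ, E).tangent p₀).map_target hy
  have hinv := mfderiv_extChartAt_comp_mfderivWithin_extChartAt_symm
    (I := 𝓘(ℝ, E).tangent) hy
  rw [ModelWithCorners.range_eq_univ, mfderivWithin_univ] at hinv
  refine ContinuousLinearMap.ext fun a => ?_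
  set u : TangentSpace 𝓘(ℝ, E).tangent ((extChartAt 𝓘(ℝ, E).tangent p₀).symm y) :=
    mfderiv 𝓘(ℝ, E × E) 𝓘(ℝ, E).tangent (extChartAt 𝓘(ℝ, E).tangent p₀).symm y a
  have hu : chartDifferential p₀ ((extChartAt 𝓘(ℝ, E).tangent p₀).symm y) u = a :=
    congrArg (fun g : E × E →L[ℝ] E × E => g a) hinv
  have h1 := (differential_eq_fderiv_funInChart hL hp
    (verticalEndo ((extChartAt 𝓘(ℝ, E).tangent p₀).symm y) u))
  have h2 : chartDifferential p₀ ((extChartAt 𝓘(ℝ, E).tangent p₀).symm y) (verticalEndo _ u) =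
      modelVerticalEndo E a :=
    (chartDifferential_verticalEndo hp u).trans (congrArg (modelVerticalEndo E) hu)
  refine h1.trans ?_
  rw [(extChartAt 𝓘(ℝ, E).tangent p₀).right_inv hy]
  exact congrArg (fderiv ℝ (funInChart L p₀) y) h2

theorem cartanTwoForm_eq_modelCartanTwoForm (hL : ContMDiff 𝓘(ℝ, E).tangent 𝓘(ℝ, ℝ) ∞ L)
    {p₀ p : TangentBundle 𝓘(ℝ, E) Q} (hp : p ∈ (extChartAt 𝓘(ℝ, E).tangent p₀).source)
    (u v : TangentSpace 𝓘(ℝ, E).tangent p) :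
    cartanTwoForm L p u v =
      modelCartanTwoForm (funInChart L p₀) (extChartAt 𝓘(ℝ, E).tangent p₀ p)
        (chartDifferential p₀ p u)
        (chartDifferential p₀ p v) := by
  have hy := (extChartAt 𝓘(ℝ, E).tangent p₀).map_source hp
  have hl := contDiffAt_funInChart hL p₀ hy
  have h1 : HasFDerivAt (fderiv ℝ (funInChart L p₀))
      (fderiv ℝ (fderiv ℝ (funInChart L p₀)) (extChartAt 𝓘(ℝ, E).tangent p₀ p))
      (extChartAt 𝓘(ℝ, E).tangent p₀ p) :=
    ((hl.fderiv_right (m := 1) (by norm_cast)).differentiableAt (by simp)).hasFDerivAt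
  have heq : oneFormInChart 𝓘(ℝ, E).tangent (cartanOneForm L) p₀
      =ᶠ[𝓝 (extChartAt 𝓘(ℝ, E).tangent p₀ p)]
      fun y => ContinuousLinearMap.precomp ℝ (modelVerticalEndo E)
        (fderiv ℝ (funInChart L p₀) y) := by
    filter_upwards [extChartAt_target_mem_nhds' (I := 𝓘(ℝ, E).tangent) hy] with y hy
    exact oneFormInChart_cartanOneForm hL hy
  have h2 := ((ContinuousLinearMap.precomp ℝ (modelVerticalEndo E) :
    (E × E →L[ℝ] ℝ) →L[ℝ] (E × E →L[ℝ] ℝ)).hasFDerivAt.comp _ h1).congr_of_eventuallyEq heq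
  have h3 := extDerivOneForm_eq_fderiv_oneFormInChart 𝓘(ℝ, E).tangent (cartanOneForm L) hp
    h2.differentiableAt u v
  rw [h2.fderiv] at h3
  exact (congrArg Neg.neg h3).trans (neg_sub _ _)

end LagrangianInCoordinates

/-! ### Pointwise properties of the Cartan form -/

section Pointwise

open Filter Topology

variable {E : Type*} [NormedAddCommGroup E] [NormedSpace ℝ E]
  {Q : Type*} [TopologicalSpace Q] [ChartedSpace E Q] [IsManifold 𝓘(ℝ, E) ∞ Q]
  {L : TangentBundle 𝓘(ℝ, E) Q → ℝ}

theorem isInvertible_chartDifferential {p₀ p : TangentBundle 𝓘(ℝ, E) Q}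
    (hp : p ∈ (extChartAt 𝓘(ℝ, E).tangent p₀).source) : (chartDifferential p₀ p).IsInvertible := by
  have : IsManifold 𝓘(ℝ, E).tangent 1 (TangentBundle 𝓘(ℝ, E) Q) := .of_le (n := ∞) (by simp)
  exact isInvertible_mfderiv_extChartAt hp

theorem verticalEndo_verticalEndo (p : TangentBundle 𝓘(ℝ, E) Q)
    (u : TangentSpace 𝓘(ℝ, E).tangent p) : verticalEndo p (verticalEndo p u) = 0 := by
  have hp := mem_extChartAt_source (I := 𝓘(ℝ, E).tangent) p
  apply (isInvertible_chartDifferential hp).injective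
  rw [chartDifferential_verticalEndo hp, chartDifferential_verticalEndo hp, map_zero]
  rfl

theorem cartanTwoForm_antisymm (p : TangentBundle 𝓘(ℝ, E) Q)
    (u v : TangentSpace 𝓘(ℝ, E).tangent p) : cartanTwoForm L p u v = -cartanTwoForm L p v u := by
  have h1 : ∀ u v : TangentSpace 𝓘(ℝ, E).tangent p, cartanTwoForm L p u v =
      -extDerivOneForm 𝓘(ℝ, E).tangent (cartanOneForm L) p u v := fun _ _ => rfl
  rw [h1, h1, extDerivOneForm_apply, extDerivOneForm_apply]
  ring

/-- `ω_L (S u, v) = - ω_L (u, S v)`: in coordinates, both sides come from the symmetric second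
derivative of `L` along the fibres. -/
theorem cartanTwoForm_verticalEndo_left (hL : ContMDiff 𝓘(ℝ, E).tangent 𝓘(ℝ, ℝ) ∞ L)
    (p : TangentBundle 𝓘(ℝ, E) Q) (u v : TangentSpace 𝓘(ℝ, E).tangent p) :
    cartanTwoForm L p (verticalEndo p u) v = -cartanTwoForm L p u (verticalEndo p v) := by
  have hp := mem_extChartAt_source (I := 𝓘(ℝ, E).tangent) p
  have hl := contDiffAt_funInChart hL p ((extChartAt 𝓘(ℝ, E).tangent p).map_source hp)
  have hsymm := fderiv_fderiv_symm hl
  rw [cartanTwoForm_eq_modelCartanTwoForm hL hp, cartanTwoForm_eq_modelCartanTwoForm hL hp,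
    chartDifferential_verticalEndo hp, chartDifferential_verticalEndo hp,
    modelCartanTwoForm_apply, modelCartanTwoForm_apply]
  have h0 : ((0 : E), (0 : E)) = 0 := rfl
  simp only [modelVerticalEndo_apply, h0, map_zero, zero_sub, sub_zero]
  rw [hsymm]

/-- `dE_L ∘ S = - i_Δ ω_L`, the reason why Euler–Lagrange fields are of second order. -/
theorem differential_energy_verticalEndo (hL : ContMDiff 𝓘(ℝ, E).tangent 𝓘(ℝ, ℝ) ∞ L)
    (p : TangentBundle 𝓘(ℝ, E) Q) (u : TangentSpace 𝓘(ℝ, E).tangent p) :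
    differential (energy L) p (verticalEndo p u) = -cartanTwoForm L p (liouville p) u := by
  have hp := mem_extChartAt_source (I := 𝓘(ℝ, E).tangent) p
  have hl := contDiffAt_funInChart hL p ((extChartAt 𝓘(ℝ, E).tangent p).map_source hp)
  have hsymm := fderiv_fderiv_symm hl
  rw [cartanTwoForm_eq_modelCartanTwoForm hL hp, differential_energy_eq_fderiv hL hp,
    fderiv_modelEnergy hl, chartDifferential_verticalEndo hp, chartDifferential_liouville hp,
    modelCartanTwoForm_apply]
  have h0 : ((0 : E), (0 : E)) = 0 := rfl
  simp only [modelVerticalEndo_apply, modelLiouville_apply, h0, map_zero, zero_sub]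
  rw [hsymm]
  ring

/-- Every solution `X` of `i_X ω_L = dE_L + S* α` satisfies `S (X) = Δ`: the form `S* α` vanishes
on vertical vectors, and `dE_L ∘ S = - i_Δ ω_L`. -/
theorem verticalEndo_eq_liouville (hL : ContMDiff 𝓘(ℝ, E).tangent 𝓘(ℝ, ℝ) ∞ L)
    (hreg : IsRegular L) {p : TangentBundle 𝓘(ℝ, E) Q} {X : TangentSpace 𝓘(ℝ, E).tangent p}
    {α : TangentSpace 𝓘(ℝ, E).tangent p →L[ℝ] ℝ}
    (hX : cartanTwoForm L p X = differential (energy L) p + verticalEndoDual p α) :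
    verticalEndo p X = liouville p := by
  apply (hreg p).injective
  ext w
  have h : verticalEndoDual p α (verticalEndo p w) = 0 :=
    (congrArg α (verticalEndo_verticalEndo p w)).trans (map_zero α)
  rw [cartanTwoForm_verticalEndo_left hL, hX, add_apply, h,
    differential_energy_verticalEndo hL]
  simp

theorem hessian_self_eq {p : TangentBundle 𝓘(ℝ, E) Q} (hreg : IsRegular L)
    (α : TangentSpace 𝓘(ℝ, E).tangent p →L[ℝ] ℝ) :
    hessian L p α α = -α (poissonSharp L p (verticalEndoDual p α)) := by
  rw [apply_poissonSharp hreg, hessian, poissonTensor, cartanTwoForm_antisymm, poissonTensor]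

/-- Transversality of `D` and `Λ_L (S* (D⁰))` for a definite Lagrangian: if `w ∈ D` is
`Λ_L (S* α)` with `α ∈ D⁰`, then `H_L (α, α) = -α (w) = 0`, so that `S* α = 0`. -/
theorem eq_zero_of_cartanTwoForm_eq_verticalEndoDual (hL : IsDefinite L)
    {p : TangentBundle 𝓘(ℝ, E) Q} {W : Submodule ℝ (TangentSpace 𝓘(ℝ, E).tangent p)}
    (hW : Set.InjOn (verticalEndoDual p) (annihilator W))
    {α : TangentSpace 𝓘(ℝ, E).tangent p →L[ℝ] ℝ} (hα : α ∈ annihilator W)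
    {w : TangentSpace 𝓘(ℝ, E).tangent p} (hw : w ∈ W)
    (h : cartanTwoForm L p w = verticalEndoDual p α) : α = 0 ∧ w = 0 := by
  have hΛ : poissonSharp L p (verticalEndoDual p α) = w :=
    ((hL.1 p).inverse_apply_eq).2 h.symm
  have hS : verticalEndoDual p α = 0 := by
    by_contra hne
    have hH : hessian L p α α = 0 := by rw [hessian_self_eq hL.1, hΛ, hα w hw, neg_zero]
    rcases hL.2 p with hpos | hneg
    · exact (hpos α hne).ne' hH
    · exact (hneg α hne).ne hH
  refine ⟨hW hα (zero_mem _) (hS.trans (map_zero _).symm), ?_⟩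
  exact (hL.1 p).injective (by rw [h, hS, map_zero])

/-- The affine condition `X ∈ Γ_L + Λ_L (F)`, freed of the inverse of `ω̂_L`. -/
theorem eq_eulerLagrangeField_add_iff (hreg : IsRegular L) {p : TangentBundle 𝓘(ℝ, E) Q}
    {X : TangentSpace 𝓘(ℝ, E).tangent p} {f : TangentSpace 𝓘(ℝ, E).tangent p →L[ℝ] ℝ} :
    X = eulerLagrangeField L p + poissonSharp L p f ↔
      cartanTwoForm L p X = differential (energy L) p + f := by
  rw [eulerLagrangeField, ← map_add, eq_comm, poissonSharp, (hreg p).inverse_apply_eq, eq_comm]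

end Pointwise

/-! ### The linear system for the constrained field -/

section ConstraintSystem

variable {V : Type*} [NormedAddCommGroup V] [NormedSpace ℝ V] {k : ℕ}

/-- The linear map `(a, α) ↦ (Ω (∑ aᵢ xᵢ) - α ∘ S, (α (xᵢ))ᵢ)`. Solving
`constraintSystem Ω S x (a, α) = (η, 0)` amounts to finding `X = ∑ aᵢ xᵢ` in the span of the `xᵢ`
and `α` in its annihilator with `Ω (X) = η + S* α`. -/
def constraintSystem (Ω : V →L[ℝ] V →L[ℝ] ℝ) (S : V →L[ℝ] V) (x : Fin k → V) :
    (Fin k → ℝ) × (V →L[ℝ] ℝ) →L[ℝ] (V →L[ℝ] ℝ) × (Fin k → ℝ) :=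
  ((Ω.comp (∑ i, (ContinuousLinearMap.proj i : (Fin k → ℝ) →L[ℝ] ℝ).smulRight (x i))).comp
      (ContinuousLinearMap.fst ℝ _ _) -
    (ContinuousLinearMap.precomp ℝ S).comp (ContinuousLinearMap.snd ℝ _ _)).prod
  (ContinuousLinearMap.pi fun i =>
    (ContinuousLinearMap.apply ℝ ℝ (x i)).comp (ContinuousLinearMap.snd ℝ _ _))

theorem constraintSystem_apply (Ω : V →L[ℝ] V →L[ℝ] ℝ) (S : V →L[ℝ] V) (x : Fin k → V)
    (a : Fin k → ℝ) (α : V →L[ℝ] ℝ) :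
    constraintSystem Ω S x (a, α) = (Ω (∑ i, a i • x i) - α.comp S, fun i => α (x i)) := by
  refine Prod.ext ?_ rfl
  simp only [constraintSystem, ContinuousLinearMap.prod_apply, sub_apply,
    ContinuousLinearMap.comp_apply, ContinuousLinearMap.coe_fst', ContinuousLinearMap.coe_snd',
    sum_apply, ContinuousLinearMap.smulRight_apply,
    ContinuousLinearMap.proj_apply]
  rfl

theorem contDiff_constraintSystem [FiniteDimensional ℝ V] (S : V →L[ℝ] V) :
    ContDiff ℝ ∞ (fun q : (V →L[ℝ] V →L[ℝ] ℝ) × (Fin k → V) => constraintSystem q.1 S q.2) := by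
  rw [contDiff_clm_apply_iff]
  rintro ⟨a, α⟩
  simp only [constraintSystem_apply]
  refine ContDiff.prodMk (ContDiff.sub ?_ contDiff_const) (contDiff_pi.2 fun i => ?_)
  · exact contDiff_fst.clm_apply (ContDiff.sum fun i _ =>
      contDiff_const.smul ((contDiff_apply ℝ V i).comp contDiff_snd))
  · exact α.contDiff.comp ((contDiff_apply ℝ V i).comp contDiff_snd)

theorem contMDiffAt_constraintSystem [FiniteDimensional ℝ V] {G C : Type*}
    [NormedAddCommGroup G] [NormedSpace ℝ G] [TopologicalSpace C] [ChartedSpace G C] {c₀ : C}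
    {Ω : C → V →L[ℝ] V →L[ℝ] ℝ} {x : C → Fin k → V}
    (hΩ : ContMDiffAt 𝓘(ℝ, G) 𝓘(ℝ, V →L[ℝ] V →L[ℝ] ℝ) ∞ Ω c₀)
    (hx : ContMDiffAt 𝓘(ℝ, G) 𝓘(ℝ, Fin k → V) ∞ x c₀) (S : V →L[ℝ] V) :
    ContMDiffAt 𝓘(ℝ, G) 𝓘(ℝ, (Fin k → ℝ) × (V →L[ℝ] ℝ) →L[ℝ] (V →L[ℝ] ℝ) × (Fin k → ℝ)) ∞
      (fun c => constraintSystem (Ω c) S (x c)) c₀ := by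
  have h := (contDiff_constraintSystem S).comp_contMDiffAt (hΩ.prodMk_space hx)
  exact h

/-- The constraint system has as many equations as unknowns, so it is invertible as soon as it is
injective. -/
theorem isInvertible_constraintSystem [FiniteDimensional ℝ V] {Ω : V →L[ℝ] V →L[ℝ] ℝ}
    {S : V →L[ℝ] V} {x : Fin k → V}
    (h : ∀ (a : Fin k → ℝ) (α : V →L[ℝ] ℝ), (∀ i, α (x i) = 0) →
      Ω (∑ i, a i • x i) = α.comp S → a = 0 ∧ α = 0) :
    (constraintSystem Ω S x).IsInvertible := by
  have hinj : Function.Injective (constraintSystem Ω S x).toLinearMap := by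
    rw [← LinearMap.ker_eq_bot, LinearMap.ker_eq_bot']
    rintro ⟨a, α⟩ h0
    have h1 := (constraintSystem_apply Ω S x a α).symm.trans h0
    obtain ⟨h2, h3⟩ := Prod.ext_iff.1 h1
    obtain ⟨rfl, rfl⟩ := h a α (fun i => congrFun h3 i) (sub_eq_zero.1 h2)
    rfl
  have hdim : Module.finrank ℝ ((Fin k → ℝ) × (V →L[ℝ] ℝ)) =
      Module.finrank ℝ ((V →L[ℝ] ℝ) × (Fin k → ℝ)) := by
    rw [Module.finrank_prod, Module.finrank_prod, add_comm]
  exact ⟨(LinearMap.linearEquivOfInjective _ hinj hdim).toContinuousLinearEquiv,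
    ContinuousLinearMap.ext fun _ => rfl⟩

end ConstraintSystem

/-! ### Smooth local solutions -/

section Existence

open Filter Topology

variable {E : Type*} [NormedAddCommGroup E] [NormedSpace ℝ E]
  {Q : Type*} [TopologicalSpace Q] [ChartedSpace E Q] [IsManifold 𝓘(ℝ, E) ∞ Q]
  {G : Type*} [NormedAddCommGroup G] [NormedSpace ℝ G]
  {C : Type*} [TopologicalSpace C] [ChartedSpace G C]
  {ι : C → TangentBundle 𝓘(ℝ, E) Q}

/-- A vector field along `ι` is smooth at `c₀` exactly when its components in the natural chart
around `ι c₀` are. -/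
theorem contMDiffAt_along_iff {c₀ : C} (hι : ContMDiffAt 𝓘(ℝ, G) 𝓘(ℝ, E).tangent ∞ ι c₀)
    (X : ∀ c, TangentSpace 𝓘(ℝ, E).tangent (ι c)) :
    ContMDiffAt 𝓘(ℝ, G) 𝓘(ℝ, E).tangent.tangent ∞
      (fun c => (⟨ι c, X c⟩ : TangentBundle 𝓘(ℝ, E).tangent (TangentBundle 𝓘(ℝ, E) Q))) c₀ ↔
    ContMDiffAt 𝓘(ℝ, G) 𝓘(ℝ, E × E) ∞ (fun c => chartDifferential (ι c₀) (ι c) (X c)) c₀ := by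
  have : IsManifold 𝓘(ℝ, E).tangent 1 (TangentBundle 𝓘(ℝ, E) Q) := .of_le (n := ∞) (by simp)
  have heq : (fun c => (trivializationAt (E × E) (TangentSpace 𝓘(ℝ, E).tangent :
        TangentBundle 𝓘(ℝ, E) Q → Type _) (ι c₀) ⟨ι c, X c⟩).2) =ᶠ[𝓝 c₀]
      fun c => chartDifferential (ι c₀) (ι c) (X c) := by
    filter_upwards [hι.continuousAt.preimage_mem_nhds
      (chart_source_mem_nhds (ModelProd E E) (ι c₀))] with c hc
    exact snd_trivializationAt_tangentSpace 𝓘(ℝ, E).tangent (z := ⟨ι c, X c⟩) hc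
  refine Bundle.contMDiffAt_totalSpace.trans ⟨fun h => h.2.congr_of_eventuallyEq heq.symm,
    fun h => ⟨hι, h.congr_of_eventuallyEq heq⟩⟩

theorem chartDifferential_sum_smul {k : ℕ} (p₀ p : TangentBundle 𝓘(ℝ, E) Q) (a : Fin k → ℝ)
    (Y : Fin k → TangentSpace 𝓘(ℝ, E).tangent p) :
    chartDifferential p₀ p (∑ i, a i • Y i) = ∑ i, a i • chartDifferential p₀ p (Y i) := by
  rw [map_sum]
  exact Finset.sum_congr rfl fun i _ => map_smul _ _ _

theorem contMDiffAt_along_sum_smul {k : ℕ} {c₀ : C}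
    (hι : ContMDiffAt 𝓘(ℝ, G) 𝓘(ℝ, E).tangent ∞ ι c₀) {a : C → Fin k → ℝ}
    (ha : ContMDiffAt 𝓘(ℝ, G) 𝓘(ℝ, Fin k → ℝ) ∞ a c₀)
    {Y : Fin k → ∀ c, TangentSpace 𝓘(ℝ, E).tangent (ι c)}
    (hY : ∀ i, ContMDiffAt 𝓘(ℝ, G) 𝓘(ℝ, E × E) ∞
      (fun c => chartDifferential (ι c₀) (ι c) (Y i c)) c₀) :
    ContMDiffAt 𝓘(ℝ, G) 𝓘(ℝ, E).tangent.tangent ∞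
      (fun c => (⟨ι c, ∑ i, a c i • Y i c⟩ :
        TangentBundle 𝓘(ℝ, E).tangent (TangentBundle 𝓘(ℝ, E) Q))) c₀ := by
  rw [contMDiffAt_along_iff hι (fun c => ∑ i, a c i • Y i c)]
  simp only [chartDifferential_sum_smul]
  exact ContMDiffAt.sum fun i _ => (contMDiffAt_pi_space.1 ha i).smul (hY i)

variable [FiniteDimensional ℝ E] {L : TangentBundle 𝓘(ℝ, E) Q → ℝ}
  {D : ∀ c : C, Submodule ℝ (TangentSpace 𝓘(ℝ, E).tangent (ι c))}

/-- Near `c₀` there is a field `X` in `D` with `i_X ω_L = dE_L + S* α`, `α ∈ D⁰`, smooth at `c₀`: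
its coefficients in a smooth frame of `D` solve an invertible linear system with smooth entries. -/
theorem exists_smooth_local_solution (hL : ContMDiff 𝓘(ℝ, E).tangent 𝓘(ℝ, ℝ) ∞ L)
    (hdef : IsDefinite L) (hι : ContMDiff 𝓘(ℝ, G) 𝓘(ℝ, E).tangent ∞ ι)
    (hD : IsSubbundleAlong G ι D) (hadm : IsAdmissible ι D) (c₀ : C) :
    ∃ X : ∀ c, TangentSpace 𝓘(ℝ, E).tangent (ι c),
      ContMDiffAt 𝓘(ℝ, G) 𝓘(ℝ, E).tangent.tangent ∞
        (fun c => (⟨ι c, X c⟩ : TangentBundle 𝓘(ℝ, E).tangent (TangentBundle 𝓘(ℝ, E) Q))) c₀ ∧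
      ∀ᶠ c in 𝓝 c₀, X c ∈ D c ∧ ∃ α ∈ annihilator (D c),
        cartanTwoForm L (ι c) (X c) =
          differential (energy L) (ι c) + verticalEndoDual (ι c) α := by
  obtain ⟨U, hU, hc₀, k, Y, hYs, hY⟩ := hD c₀
  let φ := extChartAt 𝓘(ℝ, E).tangent (ι c₀)
  let l := funInChart L (ι c₀)
  -- The data of the problem in the natural chart around `ι c₀`. Only the frame of `D` is needed:
  -- the system does not involve a frame of `D⁰`.
  let y : C → E × E := fun c => φ (ι c)
  let x : C → Fin k → E × E := fun c i => chartDifferential (ι c₀) (ι c) (Y i c)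
  let M := fun c => constraintSystem (modelCartanTwoForm l (y c)) (modelVerticalEndo E) (x c)
  let η : C → E × E →L[ℝ] ℝ := fun c => fderiv ℝ (modelEnergy l) (y c)
  let z : C → (Fin k → ℝ) × (E × E →L[ℝ] ℝ) := fun c => (M c).inverse (η c, 0)
  have hsrc : ∀ᶠ c in 𝓝 c₀, c ∈ U ∧ ι c ∈ φ.source :=
    Filter.Eventually.and (hU.mem_nhds hc₀) (hι.continuous.continuousAt.preimage_mem_nhds
      (extChartAt_source_mem_nhds (I := 𝓘(ℝ, E).tangent) (ι c₀)))
  have hω : ∀ c, ι c ∈ φ.source → ∀ u v, cartanTwoForm L (ι c) u v =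
      modelCartanTwoForm l (y c) (chartDifferential (ι c₀) (ι c) u)
        (chartDifferential (ι c₀) (ι c) v) :=
    fun c hc u v => cartanTwoForm_eq_modelCartanTwoForm hL hc u v
  have hsum : ∀ c (a : Fin k → ℝ), chartDifferential (ι c₀) (ι c) (∑ i, a i • Y i c) =
      ∑ i, a i • x c i := fun c a => chartDifferential_sum_smul _ _ a _
  have hmem : ∀ c ∈ U, ∀ a : Fin k → ℝ, ∑ i, a i • Y i c ∈ D c := by
    intro c hc a
    rw [← (hY c hc).2]
    exact Submodule.sum_mem _ fun i _ => Submodule.smul_mem _ _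
      (Submodule.subset_span (Set.mem_range_self i))
  have hann : ∀ c ∈ U, ∀ α : E × E →L[ℝ] ℝ, (∀ i, α (x c i) = 0) →
      α.comp (chartDifferential (ι c₀) (ι c)) ∈ annihilator (D c) := by
    intro c hc α hα w hw
    rw [← (hY c hc).2] at hw
    induction hw using Submodule.span_induction with
    | mem w hw => obtain ⟨i, rfl⟩ := hw; exact hα i
    | zero => exact map_zero _
    | add u v _ _ hu hv => rw [map_add, hu, hv, add_zero]
    | smul r u _ hu => rw [map_smul, hu, smul_zero]
  have hM : ∀ c, c ∈ U → ι c ∈ φ.source → (M c).IsInvertible := by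
    intro c hcU hc
    have hinv := isInvertible_chartDifferential hc
    -- A vector in the kernel gives an element of `D ∩ Λ_L (S* (D⁰))`, which is trivial.
    refine isInvertible_constraintSystem fun a α hα h => ?_
    have h1 : cartanTwoForm L (ι c) (∑ i, a i • Y i c) =
        verticalEndoDual (ι c) (α.comp (chartDifferential (ι c₀) (ι c))) := by
      ext v
      rw [hω c hc, hsum, h]
      exact congrArg α (chartDifferential_verticalEndo hc v).symm
    obtain ⟨h2, h3⟩ := eq_zero_of_cartanTwoForm_eq_verticalEndoDual hdef (hadm c)
      (hann c hcU α hα) (hmem c hcU a) h1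
    refine ⟨funext fun i => (Fintype.linearIndependent_iff.1 (hY c hcU).1) a h3 i,
      ContinuousLinearMap.ext fun v => ?_⟩
    obtain ⟨u, rfl⟩ := hinv.surjective v
    exact congrArg (fun β => β u) h2
  -- Inversion of continuous linear maps is smooth, so the coefficients are smooth.
  have hy : ContMDiffAt 𝓘(ℝ, G) 𝓘(ℝ, E × E) ∞ y c₀ :=
    (contMDiffAt_extChartAt (I := 𝓘(ℝ, E).tangent)).comp c₀ hι.contMDiffAt
  have hx : ContMDiffAt 𝓘(ℝ, G) 𝓘(ℝ, Fin k → E × E) ∞ x c₀ :=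
    contMDiffAt_pi_space.2 fun i => (contMDiffAt_along_iff hι.contMDiffAt (Y i)).1
      ((hYs i).contMDiffAt (hU.mem_nhds hc₀))
  have hl : ContDiffAt ℝ ∞ l (y c₀) :=
    contDiffAt_funInChart hL (ι c₀) (mem_extChartAt_target (ι c₀))
  have hMs : ContMDiffAt 𝓘(ℝ, G)
      𝓘(ℝ, (Fin k → ℝ) × (E × E →L[ℝ] ℝ) →L[ℝ] (E × E →L[ℝ] ℝ) × (Fin k → ℝ)) ∞ M c₀ :=
    contMDiffAt_constraintSystem ((contDiffAt_modelCartanTwoForm hl).comp_contMDiffAt hy) hx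
      (modelVerticalEndo E)
  have hη : ContMDiffAt 𝓘(ℝ, G) 𝓘(ℝ, E × E →L[ℝ] ℝ) ∞ η c₀ :=
    ((contDiffAt_modelEnergy hl).fderiv_right (m := ∞) (by simp)).comp_contMDiffAt hy
  have hz : ContMDiffAt 𝓘(ℝ, G) 𝓘(ℝ, (Fin k → ℝ) × (E × E →L[ℝ] ℝ)) ∞ z c₀ := by
    have : CompleteSpace ((Fin k → ℝ) × (E × E →L[ℝ] ℝ)) := FiniteDimensional.complete ℝ _
    exact ((hM c₀ hc₀ (mem_extChartAt_source (ι c₀))).contDiffAt_map_inverse.comp_contMDiffAt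
      hMs).clm_apply (hη.prodMk_space contMDiffAt_const)
  refine ⟨fun c => ∑ i, (z c).1 i • Y i c, ?_, ?_⟩
  · exact contMDiffAt_along_sum_smul hι.contMDiffAt
      ((contDiff_fst (𝕜 := ℝ) (n := ∞)).comp_contMDiffAt hz) (contMDiffAt_pi_space.1 hx)
  · filter_upwards [hsrc] with c hc
    obtain ⟨hcU, hc⟩ := hc
    have h1 : M c ((z c).1, (z c).2) = (η c, 0) :=
      (((hM c hcU hc).inverse_apply_eq (x := z c)).1 rfl).symm
    obtain ⟨h2, h3⟩ := Prod.ext_iff.1 ((constraintSystem_apply _ _ _ _ _).symm.trans h1)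
    refine ⟨hmem c hcU _, _, hann c hcU (z c).2 fun i => congrFun h3 i, ?_⟩
    ext v
    rw [hω c hc, hsum, sub_eq_iff_eq_add.1 h2, add_apply, add_apply,
      differential_energy_eq_fderiv hL hc]
    exact congrArg (η c (chartDifferential (ι c₀) (ι c) v) + ·)
      (congrArg (z c).2 (chartDifferential_verticalEndo hc v).symm)

end Existence

end Nonholonomic

end

/-! ### Existence and uniqueness of the constrained SODE -/

theorem mainTheorem2
    {E : Type*} [NormedAddCommGroup E] [NormedSpace ℝ E] [FiniteDimensional ℝ E]
    {Q : Type*} [TopologicalSpace Q] [ChartedSpace E Q] [IsManifold 𝓘(ℝ, E) ∞ Q]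
    {G : Type*} [NormedAddCommGroup G] [NormedSpace ℝ G] [FiniteDimensional ℝ G]
    {C : Type*} [TopologicalSpace C] [ChartedSpace G C] [IsManifold 𝓘(ℝ, G) ∞ C]
    (L : TangentBundle 𝓘(ℝ, E) Q → ℝ)
    (hL_smooth : ContMDiff 𝓘(ℝ, E).tangent 𝓘(ℝ, ℝ) ∞ L)
    (hL : Nonholonomic.IsDefinite L)
    (ι : C → TangentBundle 𝓘(ℝ, E) Q)
    (hι : Manifold.IsImmersion 𝓘(ℝ, G) 𝓘(ℝ, E).tangent ∞ ι)
    (hι_inj : Function.Injective ι)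
    (D : ∀ c : C, Submodule ℝ (TangentSpace 𝓘(ℝ, E).tangent (ι c)))
    (hD : Nonholonomic.IsSubbundleAlong G ι D)
    (hD_adm : Nonholonomic.IsAdmissible ι D) :
    ∃! Γ : ∀ c : C, TangentSpace 𝓘(ℝ, E).tangent (ι c),
      Nonholonomic.IsSolution G L ι D (Nonholonomic.chetaevForces ι D) Γ ∧
        Nonholonomic.IsSODE ι Γ := by
  open Nonholonomic in
  -- `X c₀` is a solution near `c₀`; pointwise uniqueness glues the fields `X c₀` together.
  choose X hXs hX using
    exists_smooth_local_solution hL_smooth hL hι.contMDiff hD hD_adm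
  have huniq : ∀ c (u v : TangentSpace 𝓘(ℝ, E).tangent (ι c)), u ∈ D c → v ∈ D c →
      (∃ α ∈ annihilator (D c), cartanTwoForm L (ι c) u =
        differential (energy L) (ι c) + verticalEndoDual (ι c) α) →
      (∃ α ∈ annihilator (D c), cartanTwoForm L (ι c) v =
        differential (energy L) (ι c) + verticalEndoDual (ι c) α) → u = v := by
    rintro c u v hu hv ⟨α, hα, h1⟩ ⟨β, hβ, h2⟩
    refine sub_eq_zero.1 (eq_zero_of_cartanTwoForm_eq_verticalEndoDual hL (hD_adm c)
      (sub_mem hα hβ) (sub_mem hu hv) ?_).2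
    rw [map_sub, h1, h2, map_sub, add_sub_add_left_eq_sub]
  have hsol : ∀ c, X c c ∈ D c ∧ ∃ α ∈ annihilator (D c),
      cartanTwoForm L (ι c) (X c c) =
        differential (energy L) (ι c) + verticalEndoDual (ι c) α :=
    fun c => (hX c).self_of_nhds
  refine ⟨fun c => X c c, ⟨⟨fun c₀ _ => ?_, fun c => ?_, fun c => (hsol c).1⟩, fun c => ?_⟩, ?_⟩
  · refine ContMDiffAt.contMDiffWithinAt ((hXs c₀).congr_of_eventuallyEq ?_)
    filter_upwards [hX c₀] with c hc
    rw [huniq c _ _ (hsol c).1 hc.1 (hsol c).2 hc.2]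
  · obtain ⟨-, α, hα, h⟩ := hsol c
    exact ⟨_, ⟨α, hα, rfl⟩, (eq_eulerLagrangeField_add_iff hL.1).2 h⟩
  · obtain ⟨-, α, hα, h⟩ := hsol c
    exact verticalEndo_eq_liouville hL_smooth hL.1 h
  · rintro Γ ⟨hΓ, -⟩
    funext c
    obtain ⟨_, ⟨α, hα, rfl⟩, h⟩ := hΓ.mem_affine c
    exact huniq c _ _ (hΓ.mem_permitted c) (hsol c).1
      ⟨α, hα, (eq_eulerLagrangeField_add_iff hL.1).1 h⟩ (hsol c).2
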